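/- **Conventions.** A variety over a number field $K$ is geometrically integral, and $\overline K$ is an algebraic closure of $K$. Let $f:X\to X$ be a surjective endomorphism of a projective variety $X$, both defined over $K$, and let $H$ be an ample divisor on $X$. All notions below are independent of the choice of $H$. * For $d>0$, $X(d)=\{x\in X(\overline K) : [K(x):K]\le d\}$; for $Y\subseteq X_{\overline K}$, $Y(d)=Y\cap X(d)$. * The arithmetic degree of $x\in X(\overline K)$ is $\alpha_f(x)=\lim_{m\to\infty}\max\{1,h_H(f^m(x))\}^{1/m}$, where $h_H$ is the absolute logarithmic Weil height. * The first dynamical degree is $d_1(f)=\lim_{m\to\infty}\big((f^m)^*H\cdot H^{\dim X-1}\big)^{1/m}$, and it is $1$ if $\dim X=0$; it is defined in the same way for endomorphisms of subvarieties of $X_{\overline K}$. * A subvariety of $X_{\overline K}$ is an irreducible closed subset. A subvariety $V$ is $f$-invariant if $\overline{f(V)}=V$, and $f$-periodic if $\overline{f^s(V)}=V$ for some $s>0$; the least such $s$ is its period. An $f$-periodic subvariety $V$ is of small dynamical degree (SDD) if $d_1(f^s|_V)<d_1(f^s)$ for some $s>0$ with $\overline{f^s(V)}=V$. * $S_f$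 is the set of those maximal elements (for inclusion) of the set of $f$-periodic SDD subvarieties of $X_{\overline K}$ that are $f$-invariant. **Theorem.** Let $K$ be a number field. Assume the following. (Q) For every surjective endomorphism $f:X\to X$, over $K$, of a projective variety $X$ over $K$ with $d_1(f)>1$, and for every $d>0$: 1. for every $f$-invariant subvariety $Y$ of $X_{\overline K}$, the set $X(d)\cap\big(f^{-s}(Y)\setminus f^{-(s-1)}(Y)\big)$ is empty for all sufficiently large $s$; 2. there is a positive integer $N$ such that $Y(d)=\emptyset$ for every $f$-periodic SDD subvariety $Y$ of $X_{\overline K}$ whose period is larger than $N$; 3. for every $s\ge1$ the set $S_{f^s}$ of subvarieties of $X_{\overline K}$ is finite. (KS) The Kawaguchi–Silverman conjecture: for every number field $L$, every surjective endomorphism $g:Z\to Z$, over $L$, of a projective variety $Z$ over $L$, and every $z\in Z(\overline L)$ with $\alpha_g(z)<d_1(g)$, the orbit $\{g^m(z):m\ge0\}$ is not Zariski dense in $Z_{\overline L}$. Then the small Arithmetic Non-Density conjecture holds over $K$: for every surjective endomorphism $f:X\to X$, over $K$, of a projective variety $X$ over $K$, and every $d>0$, the set $\{x\in X(d) : \alpha_f(x)<d_1(f)\}$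 is not Zariski dense in $X_{\overline K}$. -/

import Mathlib

open Filter

open scoped LinearAlgebra.Projectivization ENNReal

universe u v

noncomputable section

/-! ### Projective space over a field and its Zariski topology -/

/-- The set of `k`-points of projective `n`-space. -/
def ProjSpace (k : Type v) [Field k] (n : ℕ) : Type v := ℙ k (Fin (n + 1) → k)

namespace ProjSpace

section Basic

variable {k : Type v} [Field k] {n : ℕ}

/-- The point `[w 0 : ⋯ : w n]`. -/
def mk (w : Fin (n + 1) → k) (hw : w ≠ 0) : ProjSpace k n := Projectivization.mk k w hw

/-- A choice of homogeneous coordinates of a point. -/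
def coords (x : ProjSpace k n) : Fin (n + 1) → k := Projectivization.rep x

theorem coords_ne_zero (x : ProjSpace k n) : x.coords ≠ 0 := Projectivization.rep_nonzero x

theorem exists_coords_ne_zero (x : ProjSpace k n) : ∃ j, x.coords j ≠ 0 :=
  Function.ne_iff.mp x.coords_ne_zero

/-- The Zariski topology: the sets `{F ≠ 0}`, for `F` a homogeneous polynomial, generate the open
sets. (Whether `F` vanishes at a point does not depend on the homogeneous coordinates.) -/
instance zariski : TopologicalSpace (ProjSpace k n) :=
  TopologicalSpace.generateFrom
    {U | ∃ (F : MvPolynomial (Fin (n + 1)) k) (d : ℕ), F.IsHomogeneous d ∧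
      U = {x : ProjSpace k n | MvPolynomial.eval x.coords F ≠ 0}}

/-- The residue field `F(x)`: the extension of `F` generated by all ratios of homogeneous
coordinates of `x`. -/
def residueField (F : Type u) [Field F] [Algebra F k] (x : ProjSpace k n) :
    IntermediateField F k :=
  IntermediateField.adjoin F {c | ∃ i j, x.coords j ≠ 0 ∧ c = x.coords i / x.coords j}

/-- The degree `[F(x) : F]`. -/
def degree (F : Type u) [Field F] [Algebra F k] (x : ProjSpace k n) : ℕ :=
  Module.finrank F (x.residueField F)

end Basic

section Height

variable {k : Type v} [Field k] [CharZero k] {n : ℕ}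

/-- Homogeneous coordinates of `x` that lie in `ℚ(x)`, normalised so that one of them is `1`. -/
def normCoords (x : ProjSpace k n) : Fin (n + 1) → x.residueField ℚ := fun i =>
  ⟨x.coords i / x.coords x.exists_coords_ne_zero.choose,
    IntermediateField.subset_adjoin _ _ ⟨i, _, x.exists_coords_ne_zero.choose_spec, rfl⟩⟩

open Classical in
/-- The absolute logarithmic Weil height of a point of projective space over an algebraic extension
`k` of `ℚ`, that is, the height with respect to the hyperplane class. (For such `k` the field `ℚ(x)`
is always a number field; the value `0` is only used for points that are not algebraic.) -/
def weilHeight (x : ProjSpace k n) : ℝ :=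
  if _h : FiniteDimensional ℚ (x.residueField ℚ) then
    haveI : NumberField (x.residueField ℚ) := {}
    Height.logHeight x.normCoords / (Module.finrank ℚ (x.residueField ℚ) : ℝ)
  else 0

end Height

end ProjSpace

/-! ### Projective varieties and their endomorphisms

A projective variety `X` over a number field `K` (geometrically integral) is represented by its set
of geometric points in a projective space over `k = K̄`: an irreducible Zariski closed set which is
the zero locus of homogeneous polynomials with coefficients in `K`. Its subvarieties over `K̄` are
the irreducible Zariski closed subsets. A self-map of `X` (or of a subvariety) is represented by a
function on the set of points of the ambient projective space of which only the values on `X`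
matter. -/

section Variety

variable {k : Type v} [Field k] {n : ℕ}

/-- `X` is (the set of geometric points of) a projective variety over `K`. -/
structure IsProjectiveVariety (K : Type u) [Field K] [Algebra K k] (X : Set (ProjSpace k n)) :
    Prop where
  irreducible : IsIrreducible X
  defined_over : ∃ S : Set (MvPolynomial (Fin (n + 1)) K),
    (∀ F ∈ S, ∃ d : ℕ, F.IsHomogeneous d) ∧
      X = {x | ∀ F ∈ S, MvPolynomial.aeval x.coords F = 0}

/-- `f` is a surjective endomorphism of `X` over `K`: it maps `X` onto `X`, and around each point
of `X` it is given by homogeneous polynomials of one common degree with coefficients in `K`. -/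
structure IsSurjectiveEndomorphism (K : Type u) [Field K] [Algebra K k] (X : Set (ProjSpace k n))
    (f : ProjSpace k n → ProjSpace k n) : Prop where
  mapsTo : Set.MapsTo f X X
  surjOn : Set.SurjOn f X X
  regular : ∀ x ∈ X, ∃ (d : ℕ) (F : Fin (n + 1) → MvPolynomial (Fin (n + 1)) K),
    (∀ i, (F i).IsHomogeneous d) ∧
    (fun i => MvPolynomial.aeval x.coords (F i)) ≠ 0 ∧
    ∀ y ∈ X, ∀ hy : (fun i => MvPolynomial.aeval y.coords (F i)) ≠ 0,
      f y = ProjSpace.mk (fun i => MvPolynomial.aeval y.coords (F i)) hy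

/-- `V` is an (irreducible closed) subvariety of `X` over `K̄`. -/
def IsSubvariety (X V : Set (ProjSpace k n)) : Prop :=
  V ⊆ X ∧ IsClosed V ∧ IsIrreducible V

/-- The dimension of a variety. -/
def varietyDim (V : Set (ProjSpace k n)) : ℕ :=
  ((topologicalKrullDim V).unbotD 0).toNat

/-! ### Intersection numbers and the first dynamical degree -/

/-- The biaffine cone over the graph of `f` restricted to `V`: the pairs `(u, w)` of nonzero vectors
with `[u] ∈ V` and `f [u] = [w]`. -/
def graphCone (V : Set (ProjSpace k n)) (f : ProjSpace k n → ProjSpace k n) :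
    Set (Fin (n + 1) ⊕ Fin (n + 1) → k) :=
  {p | ∃ (hu : (fun i => p (Sum.inl i)) ≠ 0) (hw : (fun i => p (Sum.inr i)) ≠ 0),
    ProjSpace.mk _ hu ∈ V ∧ f (ProjSpace.mk _ hu) = ProjSpace.mk _ hw}

/-- The bigraded Hilbert function of the graph `Γ` of `f` restricted to `V`: the dimension of the
space of restrictions to `Γ` of bihomogeneous forms of bidegree `(a, b)`. For `a` and `b` large it
is the Euler characteristic of `aH + b f^*H` on `V`, where `H` is the hyperplane class. -/
def graphHilbertFunction (V : Set (ProjSpace k n)) (f : ProjSpace k n → ProjSpace k n)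
    (a b : ℕ) : ℕ :=
  Module.finrank k
    ((MvPolynomial.weightedHomogeneousSubmodule k
        (Sum.elim (fun _ : Fin (n + 1) => ((1, 0) : ℕ × ℕ)) (fun _ : Fin (n + 1) => (0, 1)))
        (a, b)).map
      (LinearMap.pi fun p : graphCone V f => (MvPolynomial.aeval p.1).toLinearMap))

/-- `P` is the bigraded Hilbert polynomial of the graph of `f` restricted to `V`. There is exactly
one such `P`, for `f` a self-morphism of the closed set `V`. -/
def IsGraphHilbertPolynomial (V : Set (ProjSpace k n)) (f : ProjSpace k n → ProjSpace k n)
    (P : MvPolynomial (Fin 2) ℚ) : Prop :=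
  ∀ᶠ ab : ℕ × ℕ in atTop,
    MvPolynomial.eval ![(ab.1 : ℚ), (ab.2 : ℚ)] P = graphHilbertFunction V f ab.1 ab.2

open Classical in
/-- The bigraded Hilbert polynomial of the graph of `f` restricted to `V`. -/
def graphHilbertPolynomial (V : Set (ProjSpace k n)) (f : ProjSpace k n → ProjSpace k n) :
    MvPolynomial (Fin 2) ℚ :=
  if h : ∃ P, IsGraphHilbertPolynomial V f P then h.choose else 0

/-- The intersection number `(f^*H · H^(d-1))` on the variety `V` of dimension `d`, where `H` is the
hyperplane class, as in Snapper's definition: the Hilbert polynomial has total degree `d` and its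
part of degree `d` is the sum of the terms `(H^i · (f^*H)^j) / (i! j!) * a^i * b^j` with
`i + j = d`. On a point it is `1` by convention, so that the dynamical degree of a point is `1`. -/
def pullbackDegree (V : Set (ProjSpace k n)) (f : ProjSpace k n → ProjSpace k n) : ℚ :=
  if varietyDim V = 0 then 1
  else (Nat.factorial (varietyDim V - 1) : ℚ) *
    (graphHilbertPolynomial V f).coeff
      (Finsupp.single 0 (varietyDim V - 1) + Finsupp.single 1 1)

/-- The first dynamical degree `d₁(f|_V)`, the limit of `((f^m)^*H · H^(d-1))^(1/m)`. The limit
exists, and is written as a lower limit. -/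
def dynamicalDegree (V : Set (ProjSpace k n)) (f : ProjSpace k n → ProjSpace k n) : ℝ≥0∞ :=
  liminf (fun m : ℕ => ENNReal.ofReal (pullbackDegree V (f^[m]) : ℝ) ^ (1 / (m : ℝ))) atTop

/-! ### Arithmetic degrees and points of bounded degree -/

/-- The arithmetic degree `α_f(x)`, the limit of `max(1, h_H(f^m(x)))^(1/m)` where `H` is the
hyperplane class. The limit exists, and is written as an upper limit. -/
def arithmeticDegree [CharZero k] (f : ProjSpace k n → ProjSpace k n) (x : ProjSpace k n) : ℝ≥0∞ :=
  limsup (fun m : ℕ => ENNReal.ofReal (max 1 (f^[m] x).weilHeight) ^ (1 / (m : ℝ))) atTop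

/-- `V(d)`: the points `x` of `V` with `[K(x) : K] ≤ d`. -/
def pointsOfDegreeLE (K : Type u) [Field K] [Algebra K k] (V : Set (ProjSpace k n)) (d : ℝ) :
    Set (ProjSpace k n) :=
  {x ∈ V | (x.degree K : ℝ) ≤ d}

/-! ### Periodic subvarieties of small dynamical degree -/

/-- `V` is `f`-invariant: the closure of `f(V)` is `V`. -/
def IsInvariantSet (f : ProjSpace k n → ProjSpace k n) (V : Set (ProjSpace k n)) : Prop :=
  closure (f '' V) = V

/-- The period of `V`: the least `s > 0` such that `V` is `f^s`-invariant. -/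
def period (f : ProjSpace k n → ProjSpace k n) (V : Set (ProjSpace k n)) : ℕ :=
  sInf {s | 0 < s ∧ IsInvariantSet (f^[s]) V}

/-- The set of `f`-periodic subvarieties of `X` of small dynamical degree. -/
def smallDegreePeriodic (X : Set (ProjSpace k n)) (f : ProjSpace k n → ProjSpace k n) :
    Set (Set (ProjSpace k n)) :=
  {V | IsSubvariety X V ∧ ∃ s : ℕ, 0 < s ∧ IsInvariantSet (f^[s]) V ∧
    dynamicalDegree V (f^[s]) < dynamicalDegree X (f^[s])}

/-- The set `S_f`: the `f`-invariant ones among the maximal `f`-periodic subvarieties of small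
dynamical degree. -/
def invariantMaximalSmallDegree (X : Set (ProjSpace k n)) (f : ProjSpace k n → ProjSpace k n) :
    Set (Set (ProjSpace k n)) :=
  {V | Maximal (fun W => W ∈ smallDegreePeriodic X f) V ∧ IsInvariantSet f V}

end Variety

/-! ### The questions and the conjectures over a number field `K` with algebraic closure `k` -/

section Conjectures

variable (K : Type u) [Field K] (k : Type v) [Field k] [Algebra K k]

/-- Positive answers to the three questions, for all surjective endomorphisms `f` with `d₁(f) > 1`
of projective varieties over `K` and all `d > 0`. -/
def PositiveAnswers : Prop :=
  ∀ (n : ℕ) (X : Set (ProjSpace k n)) (f : ProjSpace k n → ProjSpace k n),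
    IsProjectiveVariety K X → IsSurjectiveEndomorphism K X f → 1 < dynamicalDegree X f →
    ∀ d : ℝ, 0 < d →
      (∀ Y, IsSubvariety X Y → IsInvariantSet f Y →
        ∃ s₀ : ℕ, ∀ s ≥ s₀,
          pointsOfDegreeLE K X d ∩ (f^[s + 1] ⁻¹' Y \ f^[s] ⁻¹' Y) = ∅) ∧
      (∃ N : ℕ, 0 < N ∧ ∀ Y ∈ smallDegreePeriodic X f, N < period f Y →
        pointsOfDegreeLE K Y d = ∅) ∧
      (∀ s : ℕ, 1 ≤ s → (invariantMaximalSmallDegree X (f^[s])).Finite)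

/-- The Kawaguchi–Silverman conjecture for projective varieties over `K`. -/
def KawaguchiSilvermanConjecture [CharZero k] : Prop :=
  ∀ (n : ℕ) (X : Set (ProjSpace k n)) (f : ProjSpace k n → ProjSpace k n),
    IsProjectiveVariety K X → IsSurjectiveEndomorphism K X f →
    ∀ x ∈ X, arithmeticDegree f x < dynamicalDegree X f →
      ¬ X ⊆ closure (Set.range fun m : ℕ => f^[m] x)

/-- The small Arithmetic Non-Density conjecture for projective varieties over `K`. -/
def SmallArithmeticNonDensityConjecture [CharZero k] : Prop :=
  ∀ (n : ℕ) (X : Set (ProjSpace k n)) (f : ProjSpace k n → ProjSpace k n),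
    IsProjectiveVariety K X → IsSurjectiveEndomorphism K X f →
    ∀ d : ℝ, 0 < d →
      ¬ X ⊆ closure {x ∈ pointsOfDegreeLE K X d | arithmeticDegree f x < dynamicalDegree X f}

end Conjectures

end

/-! If `d₁(f) ≤ 1` there are no points of small arithmetic degree, because `α_f ≥ 1`. Otherwise let
`N` be the period bound of the second question and `g = f^[N!]`. Let `x ∈ X(d)` satisfy `α_f(x) <
d₁(f)`; this inequality passes to iterates (`arithmeticDegree_iterate_lt`).

Some forward iterate of `x` has, under a power of `g`, an orbit whose closure `W` is irreducible and
invariant under that power (`exists_isIrreducible_closure_orbit`). The orbit is dense in `W`, so the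
Kawaguchi–Silverman conjecture on `W` forces `W` to be of small dynamical degree
(`exists_mem_smallDegreePeriodic`). Enlarge `W` to a maximal such `V`
(`exists_le_maximal_of_isIrreducible`). Regular maps over `K` do not raise the degree of a point
(`IsRegularOn.degree_le`), so `V(d)` is nonempty and `V` has `f`-period at most `N`. The period then
divides `N!`, so `V` is `g`-invariant, that is, `V ∈ S_g`.

The third question makes `S_g` finite, and the first gives for each `V ∈ S_g` one exponent `s` such
that every point of `X(d)` whose `g`-orbit meets `V` satisfies `g^[s] x ∈ V`. The small points thus
lie in a finite union of closed sets `X ∩ g^{-s}(V)`. If they were dense, irreducibility would put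
`X` inside one of these sets, surjectivity would give `V = X`, and this contradicts `d₁(V) < d₁(X)`
for a suitable iterate.

Applying the conjecture to `W` uses two facts of projective geometry: closed sets are defined over
finite extensions, and images of closed sets are closed (`IsRegularOn.isClosed_image`, by
elimination theory). -/

noncomputable section

/-! ### Zariski topology: homogeneous ideals, Noetherianity, fields of definition -/

namespace ProjSpace

open MvPolynomial TopologicalSpace

section Zariski

variable {k : Type v} [Field k] {n : ℕ}

theorem exists_coords_mk (w : Fin (n + 1) → k) (hw : w ≠ 0) :
    ∃ a : k, a ≠ 0 ∧ (mk w hw).coords = a • w := by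
  obtain ⟨a, ha⟩ := Projectivization.exists_smul_eq_mk_rep k w hw
  exact ⟨a, a.ne_zero, ha.symm⟩

theorem mk_coords (x : ProjSpace k n) : mk x.coords x.coords_ne_zero = x :=
  Projectivization.mk_rep x

theorem mk_eq_of_smul {v w : Fin (n + 1) → k} (hv : v ≠ 0) (hw : w ≠ 0) (a : k)
    (h : a • w = v) : mk v hv = mk w hw :=
  (Projectivization.mk_eq_mk_iff' k v w hv hw).2 ⟨a, h⟩

theorem aeval_smul_of_isHomogeneous {K : Type u} [Field K] [Algebra K k]
    {F : MvPolynomial (Fin (n + 1)) K} {d : ℕ} (hF : F.IsHomogeneous d) (a : k)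
    (w : Fin (n + 1) → k) : aeval (a • w) F = a ^ d * aeval w F := by
  rw [aeval_def, aeval_def, eval₂_eq, eval₂_eq, Finset.mul_sum]
  refine Finset.sum_congr rfl fun m hm => ?_
  have h : ∑ i ∈ m.support, m i = d := by
    rw [← Finsupp.degree_apply]
    by_contra h
    exact mem_support_iff.1 hm (hF.coeff_eq_zero h)
  simp only [Pi.smul_apply, smul_eq_mul, mul_pow, Finset.prod_mul_distrib,
    Finset.prod_pow_eq_pow_sum, h]
  ring

theorem aeval_coords_mk_eq_zero_iff {K : Type u} [Field K] [Algebra K k]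
    {F : MvPolynomial (Fin (n + 1)) K} {d : ℕ} (hF : F.IsHomogeneous d)
    (w : Fin (n + 1) → k) (hw : w ≠ 0) : aeval (mk w hw).coords F = 0 ↔ aeval w F = 0 := by
  obtain ⟨a, ha, h⟩ := exists_coords_mk w hw
  rw [h, aeval_smul_of_isHomogeneous hF, mul_eq_zero, or_iff_right (pow_ne_zero _ ha)]

theorem eval_coords_mk_eq_zero_iff {F : MvPolynomial (Fin (n + 1)) k} {d : ℕ}
    (hF : F.IsHomogeneous d) (w : Fin (n + 1) → k) (hw : w ≠ 0) :
    eval (mk w hw).coords F = 0 ↔ eval w F = 0 := by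
  simpa only [aeval_eq_eval] using! aeval_coords_mk_eq_zero_iff hF w hw

theorem isOpen_eval_ne_zero {F : MvPolynomial (Fin (n + 1)) k} {d : ℕ} (hF : F.IsHomogeneous d) :
    IsOpen {x : ProjSpace k n | eval x.coords F ≠ 0} :=
  isOpen_generateFrom_of_mem ⟨F, d, hF, rfl⟩

theorem isClosed_eval_eq_zero {F : MvPolynomial (Fin (n + 1)) k} {d : ℕ} (hF : F.IsHomogeneous d) :
    IsClosed {x : ProjSpace k n | eval x.coords F = 0} := by
  have h := (isOpen_eval_ne_zero hF).isClosed_compl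
  simpa [Set.compl_ofPred] using h

theorem isTopologicalBasis_zariski :
    IsTopologicalBasis {U | ∃ (F : MvPolynomial (Fin (n + 1)) k) (d : ℕ), F.IsHomogeneous d ∧
      U = {x : ProjSpace k n | eval x.coords F ≠ 0}} where
  exists_subset_inter := by
    rintro _ ⟨F, d, hF, rfl⟩ _ ⟨G, e, hG, rfl⟩ x ⟨hx, hx'⟩
    refine ⟨_, ⟨F * G, d + e, hF.mul hG, rfl⟩, ?_, ?_⟩
    · simpa using ⟨hx, hx'⟩
    · intro y hy
      simpa using hy
  sUnion_eq := by
    refine Set.eq_univ_of_forall fun x => ⟨_, ⟨1, 0, isHomogeneous_one _ _, rfl⟩, ?_⟩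
    simp
  eq_generateFrom := rfl

theorem isClosed_of_forall_exists {Z : Set (ProjSpace k n)}
    (h : ∀ x ∉ Z, ∃ (F : MvPolynomial (Fin (n + 1)) k) (d : ℕ), F.IsHomogeneous d ∧
      eval x.coords F ≠ 0 ∧ ∀ y ∈ Z, eval y.coords F = 0) : IsClosed Z := by
  rw [← isOpen_compl_iff, isTopologicalBasis_zariski.isOpen_iff]
  intro x hx
  obtain ⟨F, d, hF, h1, h2⟩ := h x hx
  exact ⟨_, ⟨F, d, hF, rfl⟩, h1, fun y hy hyZ => hy (h2 y hyZ)⟩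

/-- The homogeneous polynomials that vanish on a set of points. -/
def homogeneousVanishing (Z : Set (ProjSpace k n)) : Set (MvPolynomial (Fin (n + 1)) k) :=
  {F | (∃ d : ℕ, F.IsHomogeneous d) ∧ ∀ x ∈ Z, eval x.coords F = 0}

theorem exists_mem_homogeneousVanishing {Z : Set (ProjSpace k n)} (hZ : IsClosed Z)
    {x : ProjSpace k n} (hx : x ∉ Z) : ∃ F ∈ homogeneousVanishing Z, eval x.coords F ≠ 0 := by
  obtain ⟨_, ⟨F, d, hF, rfl⟩, h1, h2⟩ :=
    isTopologicalBasis_zariski.exists_subset_of_mem_open (u := Zᶜ) hx hZ.isOpen_compl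
  exact ⟨F, ⟨⟨d, hF⟩, fun y hy => not_not.1 fun h => h2 h hy⟩, h1⟩

/-- The homogeneous ideal of a set of points. -/
def homogeneousIdeal (Z : Set (ProjSpace k n)) : Ideal (MvPolynomial (Fin (n + 1)) k) :=
  Ideal.span (homogeneousVanishing Z)

theorem eval_eq_zero_of_mem_homogeneousIdeal {Z : Set (ProjSpace k n)}
    {F : MvPolynomial (Fin (n + 1)) k} (hF : F ∈ homogeneousIdeal Z) {x : ProjSpace k n}
    (hx : x ∈ Z) : eval x.coords F = 0 := by
  have : homogeneousIdeal Z ≤ RingHom.ker (eval x.coords) :=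
    Ideal.span_le.2 fun G hG => hG.2 x hx
  exact this hF

theorem homogeneousIdeal_anti {Z W : Set (ProjSpace k n)} (h : Z ⊆ W) :
    homogeneousIdeal W ≤ homogeneousIdeal Z :=
  Ideal.span_mono fun _ hF => ⟨hF.1, fun x hx => hF.2 x (h hx)⟩

theorem homogeneousIdeal_le_iff {Z W : Set (ProjSpace k n)} (hZ : IsClosed Z) :
    homogeneousIdeal Z ≤ homogeneousIdeal W ↔ W ⊆ Z := by
  refine ⟨fun h x hx => ?_, homogeneousIdeal_anti⟩
  by_contra hxZ
  obtain ⟨F, hF, hF'⟩ := exists_mem_homogeneousVanishing hZ hxZ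
  exact hF' (eval_eq_zero_of_mem_homogeneousIdeal (h (Ideal.subset_span hF)) hx)

/-- Hilbert's basis theorem: a strictly descending chain of closed sets yields a strictly ascending
chain of ideals. -/
instance noetherianSpace : NoetherianSpace (ProjSpace k n) := by
  refine ((noetherianSpace_TFAE _).out 0 1).2 ?_
  refine ⟨Subrelation.wf (r := InvImage (· > ·) fun Z : Closeds (ProjSpace k n) =>
    homogeneousIdeal (Z : Set (ProjSpace k n))) ?_ (InvImage.wf _ wellFounded_gt)⟩
  intro Z W h
  exact lt_of_le_not_ge (homogeneousIdeal_anti h.le) fun h' =>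
    h.not_ge ((homogeneousIdeal_le_iff Z.isClosed).1 h')

attribute [local instance] MvPolynomial.gradedAlgebra

/-- Primality of a homogeneous ideal can be tested on homogeneous elements, whose zero loci are
closed; irreducibility then applies to the two loci covering `V`. -/
theorem isPrime_homogeneousIdeal {V : Set (ProjSpace k n)} (hV : IsIrreducible V) :
    (homogeneousIdeal V).IsPrime := by
  obtain ⟨x₀, hx₀⟩ := hV.nonempty
  have hom : (homogeneousIdeal V).IsHomogeneous (homogeneousSubmodule (Fin (n + 1)) k) :=
    Ideal.homogeneous_span _ _ fun F hF => hF.1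
  refine hom.isPrime_of_homogeneous_mem_or_mem (fun h => ?_) ?_
  · have := eval_eq_zero_of_mem_homogeneousIdeal ((Ideal.eq_top_iff_one _).1 h) hx₀
    simp at this
  · rintro F G ⟨d, hF : F.IsHomogeneous d⟩ ⟨e, hG : G.IsHomogeneous e⟩ h
    have hsub : V ⊆ {x | eval x.coords F = 0} ∪ {x | eval x.coords G = 0} := fun x hx => by
      simpa using! eval_eq_zero_of_mem_homogeneousIdeal h hx
    exact (isPreirreducible_iff_isClosed_union_isClosed.1 hV.isPreirreducible _ _
      (isClosed_eval_eq_zero hF) (isClosed_eval_eq_zero hG) hsub).imp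
      (fun h' => Ideal.subset_span ⟨⟨d, hF⟩, fun x hx => h' hx⟩)
      (fun h' => Ideal.subset_span ⟨⟨e, hG⟩, fun x hx => h' hx⟩)

/-- Noetherianity controls only descending chains. Here ascending ones are needed: a strictly larger
irreducible closed set has a strictly smaller prime ideal, hence smaller height, and heights are
well-ordered. -/
theorem exists_le_maximal_of_isIrreducible {P : Set (ProjSpace k n) → Prop}
    (hP : ∀ V, P V → IsClosed V ∧ IsIrreducible V) {W : Set (ProjSpace k n)} (hW : P W) :
    ∃ V, W ⊆ V ∧ Maximal P V := by
  obtain ⟨V, ⟨hV, hWV⟩, hmin⟩ := WellFounded.has_min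
    (InvImage.wf (fun V : Set (ProjSpace k n) => (homogeneousIdeal V).height) wellFounded_lt)
    {V | P V ∧ W ⊆ V} ⟨W, hW, subset_rfl⟩
  refine ⟨V, hWV, hV, fun V' hV' hVV' => ?_⟩
  by_contra hne
  have := isPrime_homogeneousIdeal (hP V hV).2
  have := isPrime_homogeneousIdeal (hP V' hV').2
  refine hmin V' ⟨hV', hWV.trans hVV'⟩ (Ideal.height_strict_mono_of_isPrime_of_isPrime ?_)
  exact lt_of_le_not_ge (homogeneousIdeal_anti hVV') fun h =>
    hne ((homogeneousIdeal_le_iff (hP V hV).1).1 h)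

theorem exists_finite_eq_zeros {Z : Set (ProjSpace k n)} (hZ : IsClosed Z) :
    ∃ S : Finset (MvPolynomial (Fin (n + 1)) k), (∀ F ∈ S, ∃ d : ℕ, F.IsHomogeneous d) ∧
      Z = {x | ∀ F ∈ S, eval x.coords F = 0} := by
  obtain ⟨S, hS, hspan⟩ := (Submodule.fg_span_iff_fg_span_finset_subset _).1
    ((isNoetherian_def.1 inferInstance) (homogeneousIdeal Z))
  refine ⟨S, fun F hF => (hS hF).1, Set.Subset.antisymm (fun x hx F hF => (hS hF).2 x hx) ?_⟩
  intro x hx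
  by_contra hxZ
  obtain ⟨F, hF, hF'⟩ := exists_mem_homogeneousVanishing hZ hxZ
  have hle : homogeneousIdeal Z ≤ RingHom.ker (eval x.coords) := by
    unfold homogeneousIdeal Ideal.span
    rw [hspan]
    exact Ideal.span_le.2 hx
  exact hF' (hle (Ideal.subset_span hF))

/-- A closed subset of projective space over an algebraic extension `k` of `K` is defined over a
finite extension of `K`. -/
theorem exists_finite_field_of_definition (K : Type u) [Field K] [Algebra K k]
    [Algebra.IsAlgebraic K k] {Z : Set (ProjSpace k n)} (hZ : IsClosed Z) :
    ∃ L : IntermediateField K k, FiniteDimensional K L ∧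
      ∃ S : Set (MvPolynomial (Fin (n + 1)) L), (∀ F ∈ S, ∃ d : ℕ, F.IsHomogeneous d) ∧
        Z = {x | ∀ F ∈ S, aeval x.coords F = 0} := by
  classical
  obtain ⟨S, hS, hZS⟩ := exists_finite_eq_zeros hZ
  let c : Finset k := S.biUnion fun F => F.support.image F.coeff
  let L : IntermediateField K k := IntermediateField.adjoin K (c : Set k)
  have key (F : MvPolynomial (Fin (n + 1)) L) (x : ProjSpace k n) :
      eval x.coords (MvPolynomial.map (algebraMap L k) F) = aeval x.coords F := by
    rw [eval_map, aeval_def]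
  refine ⟨L, ?_, {F | MvPolynomial.map (algebraMap L k) F ∈ S}, ?_, ?_⟩
  · exact IntermediateField.finiteDimensional_adjoin fun x _ =>
      (Algebra.IsAlgebraic.isAlgebraic x).isIntegral
  · intro F hF
    obtain ⟨d, hd⟩ := hS _ hF
    exact ⟨d, hd.of_map (algebraMap L k).injective⟩
  · rw [hZS]
    ext x
    refine ⟨fun h F hF => key F x ▸ h _ hF, fun h G hG => ?_⟩
    obtain ⟨F, rfl⟩ : G ∈ Set.range (MvPolynomial.map (algebraMap L k)) := by
      refine mem_range_map_iff_coeffs_subset.2 ?_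
      intro a ha
      obtain ⟨m, hm, rfl⟩ := mem_coeffs_iff.1 (Finset.mem_coe.1 ha)
      refine ⟨⟨G.coeff m, IntermediateField.subset_adjoin _ _ ?_⟩, rfl⟩
      exact Finset.mem_coe.2 (Finset.mem_biUnion.2 ⟨G, hG, Finset.mem_image_of_mem _ hm⟩)
    rw [key]
    exact h F hG

end Zariski
end ProjSpace

/-! ### Elimination theory -/

namespace MvPolynomial

section Elimination

variable {k : Type*} [Field k] {σ τ : Type*}

/-- Every element of the ideal generated by the specialisations at `y` of polynomials with
coefficients homogeneous of degree `e` lifts to a polynomial with such coefficients. -/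
theorem exists_lift_of_mem_span {S : Set (MvPolynomial σ (MvPolynomial τ k))} {e : ℕ}
    (hS : ∀ P ∈ S, ∀ m, (P.coeff m).IsHomogeneous e) (y : τ → k) {q : MvPolynomial σ k}
    (hq : q ∈ Ideal.span (MvPolynomial.map (eval y) '' S)) :
    ∃ Q ∈ Ideal.span S, (∀ m, (Q.coeff m).IsHomogeneous e) ∧ MvPolynomial.map (eval y) Q = q := by
  classical
  induction hq using Submodule.span_induction with
  | mem q h =>
    obtain ⟨P, hP, rfl⟩ := h
    exact ⟨P, Ideal.subset_span hP, hS P hP, rfl⟩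
  | zero => exact ⟨0, zero_mem _, fun m => by simpa using isHomogeneous_zero _ _ _, map_zero _⟩
  | add q r _ _ hq hr =>
    obtain ⟨Q, hQ, hQ', rfl⟩ := hq
    obtain ⟨R, hR, hR', rfl⟩ := hr
    exact ⟨Q + R, add_mem hQ hR, fun m => by rw [coeff_add]; exact (hQ' m).add (hR' m),
      map_add _ _ _⟩
  | smul a q _ hq =>
    obtain ⟨Q, hQ, hQ', rfl⟩ := hq
    -- Lifting the multiplier `a` with constant coefficients leaves the degree `e` in the parameters
    -- unchanged.
    refine ⟨MvPolynomial.map C a * Q, Ideal.mul_mem_left _ _ hQ, fun m => ?_, ?_⟩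
    · rw [coeff_mul]
      refine IsHomogeneous.sum _ _ _ fun p _ => ?_
      rw [coeff_map]
      exact (hQ' p.2).C_mul _
    · rw [map_mul, map_map, smul_eq_mul]
      congr 1
      convert map_id a
      ext
      simp

attribute [local instance] MvPolynomial.gradedAlgebra

/-- Projective Nullstellensatz: the radical of `J` contains all variables, so `J` contains a power
of the ideal they generate. -/
theorem exists_degree_forall_monomial_mem [IsAlgClosed k] [Finite σ]
    {J : Ideal (MvPolynomial σ k)}
    (hJ : ∀ x : σ → k, x ≠ 0 → ∃ q ∈ J, eval x q ≠ 0) :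
    ∃ D : ℕ, ∀ m : σ →₀ ℕ, m.degree = D → monomial m 1 ∈ J := by
  have hle : idealOfVars σ k ≤ J.radical := by
    rw [← vanishingIdeal_zeroLocus_eq_radical (K := k), Ideal.span_le]
    rintro _ ⟨i, rfl⟩ x hx
    have : x = 0 := by
      by_contra h
      obtain ⟨q, hq, hq'⟩ := hJ x h
      exact hq' (hx q hq)
    simp [this]
  obtain ⟨D, hD⟩ := J.exists_radical_pow_le_of_fg J.radical.fg_of_isNoetherianRing
  exact ⟨D, fun m hm => hD (Ideal.pow_right_mono hle D
    ((monomial_mem_pow_idealOfVars_iff D m one_ne_zero).2 hm.ge))⟩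

theorem eval_eq_sum_finsuppAntidiag [Fintype σ] [DecidableEq σ] {p : MvPolynomial σ k} {D : ℕ}
    (hp : p.IsHomogeneous D) (x : σ → k) :
    eval x p = ∑ m : Finset.finsuppAntidiag (Finset.univ : Finset σ) D,
      coeff m.1 p * ∏ i, x i ^ m.1 i := by
  have hsub : p.support ⊆ Finset.finsuppAntidiag (Finset.univ : Finset σ) D := fun m hm => by
    have : m.degree = D := not_not.1 fun h => mem_support_iff.1 hm (hp.coeff_eq_zero h)
    simpa [Finset.mem_finsuppAntidiag, Finsupp.degree_eq_sum] using this
  rw [eval_eq', Finset.sum_coe_sort (Finset.finsuppAntidiag (Finset.univ : Finset σ) D)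
    fun m => coeff m p * ∏ i, x i ^ m i]
  exact Finset.sum_subset hsub fun m _ hm => by rw [notMem_support_iff.1 hm, zero_mul]

/-- The fundamental theorem of elimination theory: having no nontrivial common zero is an open
condition on the parameters. -/
theorem exists_isHomogeneous_forall_exists_eval_ne_zero [IsAlgClosed k] [Finite σ]
    {S : Set (MvPolynomial σ (MvPolynomial τ k))} {e : ℕ}
    (hS : ∀ P ∈ S, ∃ d : ℕ, P.IsHomogeneous d)
    (hS' : ∀ P ∈ S, ∀ m, (P.coeff m).IsHomogeneous e) (y : τ → k)
    (hy : ∀ x : σ → k, x ≠ 0 → ∃ P ∈ S, eval x (MvPolynomial.map (eval y) P) ≠ 0) :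
    ∃ (Δ : MvPolynomial τ k) (N : ℕ), Δ.IsHomogeneous N ∧ eval y Δ ≠ 0 ∧
      ∀ z : τ → k, eval z Δ ≠ 0 →
        ∀ x : σ → k, x ≠ 0 → ∃ P ∈ S, eval x (MvPolynomial.map (eval z) P) ≠ 0 := by
  classical
  have := Fintype.ofFinite σ
  obtain ⟨D, hD⟩ := exists_degree_forall_monomial_mem
    (J := Ideal.span (MvPolynomial.map (eval y) '' S)) fun x hx => by
      obtain ⟨P, hP, h⟩ := hy x hx
      exact ⟨_, Ideal.subset_span ⟨P, hP, rfl⟩, h⟩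
  let I : Type _ := Finset.finsuppAntidiag (Finset.univ : Finset σ) D
  have hI (m : σ →₀ ℕ) : m ∈ Finset.finsuppAntidiag (Finset.univ : Finset σ) D ↔ m.degree = D := by
    simp [Finset.mem_finsuppAntidiag, Finsupp.degree_eq_sum]
  have hlift (m : I) : ∃ Q ∈ Ideal.span S, (∀ m, (Q.coeff m).IsHomogeneous e) ∧
      MvPolynomial.map (eval y) Q = monomial m.1 1 :=
    exists_lift_of_mem_span hS' y (hD m.1 ((hI _).1 m.2))
  choose Q hQ hQe hQy using hlift
  -- Row `m` lists the degree-`D` coefficients of a lift of the monomial `m`. Hence `M` is the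
  -- identity at `y`, and `det M` is the required form `Δ`.
  let M : Matrix I I (MvPolynomial τ k) := Matrix.of fun m m' => (Q m).coeff m'.1
  have hdet (z : τ → k) : eval z M.det = (M.map (eval z)).det := RingHom.map_det _ _
  refine ⟨M.det, ∑ _m : I, e, ?_, ?_, ?_⟩
  · rw [Matrix.det_apply]
    refine IsHomogeneous.sum _ _ _ fun s _ => ?_
    rw [Units.smul_def, zsmul_eq_mul, ← map_intCast (C : k →+* MvPolynomial τ k)]
    exact (IsHomogeneous.prod _ _ _ fun i _ => hQe _ _).C_mul _
  · have : M.map (eval y) = 1 := by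
      ext m m'
      have := congrArg (coeff m'.1) (hQy m)
      rw [coeff_map, coeff_monomial] at this
      simp only [M, Matrix.map_apply, Matrix.of_apply, this, Matrix.one_apply]
      exact if_congr Subtype.ext_iff.symm rfl rfl
    rw [hdet, this, Matrix.det_one]
    exact one_ne_zero
  · intro z hz x hx
    by_contra! hno
    -- The generators are homogeneous, so the degree-`D` part of `Q m` stays in the ideal. The
    -- vector of degree-`D` monomials at `x` is therefore in the kernel of `M` at `z`.
    have hvan (m : I) : eval x (MvPolynomial.map (eval z) (homogeneousComponent D (Q m))) = 0 := by
      have hle : Ideal.span S ≤ RingHom.ker ((eval x).comp (MvPolynomial.map (eval z))) :=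
        Ideal.span_le.2 fun P hP => hno P hP
      exact hle (homogeneousComponent_mem_of_mem (Ideal.homogeneous_span _ _ hS) (hQ m) D)
    have hmul : (M.map (eval z)).mulVec (fun m : I => ∏ i, x i ^ m.1 i) = 0 := by
      ext m
      rw [Pi.zero_apply, ← hvan m,
        eval_eq_sum_finsuppAntidiag ((homogeneousComponent_isHomogeneous D (Q m)).map _)]
      refine Finset.sum_congr rfl fun m' _ => ?_
      rw [coeff_map, coeff_homogeneousComponent, if_pos ((hI _).1 m'.2)]
      rfl
    have hz0 := Matrix.eq_zero_of_mulVec_eq_zero (hdet z ▸ hz) hmul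
    obtain ⟨i, hi⟩ := Function.ne_iff.1 hx
    have hm : Finsupp.single i D ∈ Finset.finsuppAntidiag (Finset.univ : Finset σ) D := by
      rw [hI, Finsupp.degree_single]
    have := congrFun hz0 ⟨_, hm⟩
    rw [Pi.zero_apply, Finset.prod_eq_single i] at this
    · exact pow_ne_zero _ hi (by simpa using this)
    · intro j _ hj
      simp [hj.symm]
    · simp

end Elimination
end MvPolynomial

/-! ### Regular maps -/

section Regular

open MvPolynomial ProjSpace

variable {k : Type v} [Field k] {n : ℕ}

/-- Around each point of `X`, the map `f` is given on `X` by homogeneous polynomials of one common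
degree with coefficients in `K`. -/
def IsRegularOn (K : Type u) [Field K] [Algebra K k] (X : Set (ProjSpace k n))
    (f : ProjSpace k n → ProjSpace k n) : Prop :=
  ∀ x ∈ X, ∃ (d : ℕ) (F : Fin (n + 1) → MvPolynomial (Fin (n + 1)) K),
    (∀ i, (F i).IsHomogeneous d) ∧
    (fun i => aeval x.coords (F i)) ≠ 0 ∧
    ∀ y ∈ X, ∀ hy : (fun i => aeval y.coords (F i)) ≠ 0,
      f y = ProjSpace.mk (fun i => aeval y.coords (F i)) hy

namespace IsRegularOn

variable {K : Type u} [Field K] [Algebra K k] {X Y : Set (ProjSpace k n)}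
  {f g : ProjSpace k n → ProjSpace k n}

theorem mono (hf : IsRegularOn K X f) (h : Y ⊆ X) : IsRegularOn K Y f := fun x hx => by
  obtain ⟨d, F, h1, h2, h3⟩ := hf x (h hx)
  exact ⟨d, F, h1, h2, fun y hy => h3 y (h hy)⟩

theorem baseChange (hf : IsRegularOn K X f) (L : Type*) [Field L] [Algebra K L] [Algebra L k]
    [IsScalarTower K L k] : IsRegularOn L X f := fun x hx => by
  obtain ⟨d, F, h1, h2, h3⟩ := hf x hx
  have key (y : ProjSpace k n) :
      (fun i => aeval y.coords (MvPolynomial.map (algebraMap K L) (F i))) =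
        fun i => aeval y.coords (F i) := by
    funext i
    rw [aeval_map_algebraMap]
  refine ⟨d, fun i => MvPolynomial.map (algebraMap K L) (F i), fun i => (h1 i).map _,
    by rwa [key], fun y hy hy' => ?_⟩
  simp only [key] at hy' ⊢
  exact h3 y hy hy'

variable (K X) in
protected theorem id : IsRegularOn K X id := fun x _ => by
  have key (y : ProjSpace k n) :
      (fun i => aeval y.coords (MvPolynomial.X i : MvPolynomial (Fin (n + 1)) K)) =
        ProjSpace.coords y := by
    funext i
    rw [aeval_X]
  refine ⟨1, MvPolynomial.X, isHomogeneous_X _, ?_, fun y _ hy => ?_⟩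
  · rw [key]
    exact x.coords_ne_zero
  · simp only [key]
    exact (mk_coords y).symm

theorem comp (hg : IsRegularOn K Y g) (hf : IsRegularOn K X f) (h : Set.MapsTo f X Y) :
    IsRegularOn K X (g ∘ f) := fun x hx => by
  obtain ⟨d, F, hF, hFx, hfF⟩ := hf x hx
  obtain ⟨e, G, hG, hGx, hgG⟩ := hg (f x) (h hx)
  obtain ⟨j, hj⟩ := Function.ne_iff.1 hFx
  obtain ⟨i, hi⟩ := Function.ne_iff.1 hGx
  have key (y : ProjSpace k n) (l : Fin (n + 1)) :
      aeval y.coords (aeval F (G l) * F j) =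
        aeval (fun i => aeval y.coords (F i)) (G l) * aeval y.coords (F j) := by
    rw [map_mul, ← comp_aeval_apply]
  -- The extra factor `F j` matters when `e = 0`: it makes the tuple vanish wherever `F` does, where
  -- the formula for `f` says nothing.
  refine ⟨d * e + d, fun l => aeval F (G l) * F j, fun l => ((hG l).aeval F hF).mul (hF j), ?_, ?_⟩
  · refine Function.ne_iff.2 ⟨i, ?_⟩
    simp only [key]
    refine mul_ne_zero ?_ hj
    rw [hfF x hx hFx] at hi
    exact fun h0 => hi ((aeval_coords_mk_eq_zero_iff (hG i) _ hFx).2 h0)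
  · intro y hy hne
    obtain ⟨l, hl⟩ := Function.ne_iff.1 hne
    simp only [key] at hl
    have hFj : aeval y.coords (F j) ≠ 0 := right_ne_zero_of_mul hl
    have hFy : (fun i => aeval y.coords (F i)) ≠ 0 := Function.ne_iff.2 ⟨j, hFj⟩
    obtain ⟨a, ha, hmk⟩ := exists_coords_mk _ hFy
    have hGa (l : Fin (n + 1)) : aeval (f y).coords (G l) =
        a ^ e * aeval (fun i => aeval y.coords (F i)) (G l) := by
      rw [hfF y hy hFy, hmk, aeval_smul_of_isHomogeneous (hG l)]
    have hGy : (fun i => aeval (f y).coords (G i)) ≠ 0 := by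
      refine Function.ne_iff.2 ⟨l, ?_⟩
      rw [hGa]
      exact mul_ne_zero (pow_ne_zero _ ha) (left_ne_zero_of_mul hl)
    rw [Function.comp_apply, hgG (f y) (h hy) hGy]
    refine mk_eq_of_smul _ _ (a ^ e / aeval y.coords (F j)) ?_
    funext l
    simp only [Pi.smul_apply, key, hGa, smul_eq_mul]
    field_simp

theorem iterate (hf : IsRegularOn K X f) (h : Set.MapsTo f X X) (s : ℕ) :
    IsRegularOn K X f^[s] := by
  induction s with
  | zero => exact IsRegularOn.id K X
  | succ s ih => exact ih.comp hf h

/-- Scaling the coordinates of `x` so that one is `1` puts them in `K(x)`; ratios of values of forms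
over `K` then stay there. -/
theorem residueField_le (hf : IsRegularOn K X f) {x : ProjSpace k n} (hx : x ∈ X) :
    (f x).residueField K ≤ x.residueField K := by
  obtain ⟨d, F, hF, hFx, hfF⟩ := hf x hx
  obtain ⟨j, hj⟩ := x.exists_coords_ne_zero
  obtain ⟨a, ha, hmk⟩ := exists_coords_mk _ hFx
  have hmem (i : Fin (n + 1)) : aeval ((x.coords j)⁻¹ • x.coords) (F i) ∈ x.residueField K := by
    have hc (l : Fin (n + 1)) : ((x.coords j)⁻¹ • x.coords) l ∈ x.residueField K :=
      IntermediateField.subset_adjoin _ _ ⟨l, j, hj, by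
        rw [Pi.smul_apply, smul_eq_mul, div_eq_inv_mul]⟩
    have : aeval ((x.coords j)⁻¹ • x.coords) (F i) =
        algebraMap (x.residueField K) k (aeval (fun l => (⟨_, hc l⟩ : x.residueField K)) (F i)) := by
      rw [← aeval_algebraMap_apply]
      rfl
    rw [this]
    exact SetLike.coe_mem _
  refine IntermediateField.adjoin_le_iff.2 ?_
  rintro _ ⟨i, l, -, rfl⟩
  have hc (i : Fin (n + 1)) : (f x).coords i =
      a * x.coords j ^ d * aeval ((x.coords j)⁻¹ • x.coords) (F i) := by
    rw [hfF x hx hFx, hmk, aeval_smul_of_isHomogeneous (hF i), Pi.smul_apply, smul_eq_mul, inv_pow,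
      mul_assoc, mul_inv_cancel_left₀ (pow_ne_zero _ hj)]
  rw [hc, hc, mul_div_mul_left _ _ (mul_ne_zero ha (pow_ne_zero _ hj))]
  exact div_mem (hmem i) (hmem l)

theorem degree_le [Algebra.IsAlgebraic K k] (hf : IsRegularOn K X f) {x : ProjSpace k n}
    (hx : x ∈ X) : (f x).degree K ≤ x.degree K := by
  have hfin : FiniteDimensional K (x.residueField K) := by
    have hs : {c | ∃ i j, x.coords j ≠ 0 ∧ c = x.coords i / x.coords j}.Finite := by
      refine (Set.finite_range fun p : Fin (n + 1) × Fin (n + 1) =>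
        x.coords p.1 / x.coords p.2).subset ?_
      rintro _ ⟨i, j, -, rfl⟩
      exact ⟨(i, j), rfl⟩
    have := hs.to_subtype
    exact IntermediateField.finiteDimensional_adjoin fun c _ =>
      (Algebra.IsAlgebraic.isAlgebraic c).isIntegral
  have hle := hf.residueField_le hx
  exact LinearMap.finrank_le_finrank_of_injective
    (f := (IntermediateField.inclusion hle).toLinearMap) (IntermediateField.inclusion_injective hle)

theorem continuousOn (hf : IsRegularOn k X f) : ContinuousOn f X := by
  intro x hx
  refine (isTopologicalBasis_zariski.nhds_hasBasis).tendsto_right_iff.2 ?_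
  rintro _ ⟨⟨G, e, hG, rfl⟩, hGx⟩
  obtain ⟨d, F, hF, hFx, hfF⟩ := hf x hx
  obtain ⟨j, hj⟩ := Function.ne_iff.1 hFx
  have key (y : ProjSpace k n) : eval y.coords (F j * aeval F G) =
      aeval y.coords (F j) * aeval (fun i => aeval y.coords (F i)) G := by
    rw [← comp_aeval_apply, ← map_mul, aeval_eq_eval]
  have hiff (y : ProjSpace k n) (hy : y ∈ X) (hFy : (fun i => aeval y.coords (F i)) ≠ 0) :
      eval (f y).coords G = 0 ↔ aeval (fun i => aeval y.coords (F i)) G = 0 := by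
    rw [hfF y hy hFy]
    exact eval_coords_mk_eq_zero_iff hG _ hFy
  have hopen := isOpen_eval_ne_zero ((hF j).mul (hG.aeval F hF))
  have hxU : eval x.coords (F j * aeval F G) ≠ 0 := by
    rw [key]
    exact mul_ne_zero hj fun h => hGx ((hiff x hx hFx).2 h)
  filter_upwards [mem_nhdsWithin_of_mem_nhds (hopen.mem_nhds hxU), self_mem_nhdsWithin]
    with y (hy : eval y.coords (F j * aeval F G) ≠ 0) hyX
  rw [key] at hy
  have hFy : (fun i => aeval y.coords (F i)) ≠ 0 :=
    Function.ne_iff.2 ⟨j, left_ne_zero_of_mul hy⟩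
  exact fun h => right_ne_zero_of_mul hy ((hiff y hyX hFy).1 h)

/-- Bihomogeneous equations of the graph of a regular map `f` on `X`: homogeneous polynomials in the
coordinates of the source whose coefficients are linear forms in the coordinates of the target. -/
def graphEquations (X : Set (ProjSpace k n)) (f : ProjSpace k n → ProjSpace k n) :
    Set (MvPolynomial (Fin (n + 1)) (MvPolynomial (Fin (n + 1)) k)) :=
  {P | ∃ H ∈ homogeneousVanishing X, ∃ j, P = MvPolynomial.map C H * C (MvPolynomial.X j)} ∪
  {P | ∃ (d : ℕ) (F : Fin (n + 1) → MvPolynomial (Fin (n + 1)) k),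
    (∀ i, (F i).IsHomogeneous d) ∧
    (∀ y ∈ X, ∀ hy : (fun i => aeval y.coords (F i)) ≠ 0,
      f y = ProjSpace.mk (fun i => aeval y.coords (F i)) hy) ∧
    ∃ i j, P = MvPolynomial.map C (F i) * C (MvPolynomial.X j) -
      MvPolynomial.map C (F j) * C (MvPolynomial.X i)}

theorem eval_map_C_mul_X (F : MvPolynomial (Fin (n + 1)) k) (j : Fin (n + 1))
    (x z : Fin (n + 1) → k) :
    eval x (MvPolynomial.map (eval z) (MvPolynomial.map C F * C (MvPolynomial.X j))) =
      eval x F * z j := by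
  have : (eval z).comp C = RingHom.id k := by
    ext
    simp
  rw [map_mul, map_mul, map_C, MvPolynomial.map_map, this, MvPolynomial.map_id, eval_C, eval_X]

theorem isHomogeneous_of_mem_graphEquations {P} (hP : P ∈ graphEquations X f) :
    ∃ d : ℕ, P.IsHomogeneous d := by
  obtain ⟨H, ⟨⟨d, hH⟩, -⟩, j, rfl⟩ | ⟨d, F, hF, -, i, j, rfl⟩ := hP
  · exact ⟨d + 0, (hH.map _).mul (isHomogeneous_C _ _)⟩
  · exact ⟨d + 0, (((hF i).map _).mul (isHomogeneous_C _ _)).sub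
      (((hF j).map _).mul (isHomogeneous_C _ _))⟩

/-- Elimination requires one common degree in the target variables; this is why the equations of `X`
are multiplied by a target coordinate. -/
theorem isHomogeneous_coeff_of_mem_graphEquations {P} (hP : P ∈ graphEquations X f)
    (m : Fin (n + 1) →₀ ℕ) : (P.coeff m).IsHomogeneous 1 := by
  have key (F : MvPolynomial (Fin (n + 1)) k) (j : Fin (n + 1)) :
      (coeff m (MvPolynomial.map C F * C (MvPolynomial.X j :
        MvPolynomial (Fin (n + 1)) k))).IsHomogeneous 1 := by
    rw [mul_comm, coeff_C_mul, coeff_map, mul_comm]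
    exact (isHomogeneous_X _ _).C_mul _
  obtain ⟨H, -, j, rfl⟩ | ⟨d, F, -, -, i, j, rfl⟩ := hP
  · exact key H j
  · rw [coeff_sub]
    exact (key _ _).sub (key _ _)

theorem eval_eq_zero_of_mem_graphEquations {P} (hP : P ∈ graphEquations X f) {x : ProjSpace k n}
    (hx : x ∈ X) : eval x.coords (MvPolynomial.map (eval (f x).coords) P) = 0 := by
  obtain ⟨H, hH, j, rfl⟩ | ⟨d, F, hF, hfF, i, j, rfl⟩ := hP
  · rw [eval_map_C_mul_X, hH.2 x hx, zero_mul]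
  · rw [map_sub, map_sub, eval_map_C_mul_X, eval_map_C_mul_X]
    by_cases hFx : (fun i => aeval x.coords (F i)) = 0
    · have h0 (i : Fin (n + 1)) : eval x.coords (F i) = 0 := congrFun hFx i
      rw [h0, h0, zero_mul, zero_mul, sub_zero]
    · obtain ⟨a, -, ha⟩ := exists_coords_mk _ hFx
      rw [hfF x hx hFx, ha]
      simp only [Pi.smul_apply, smul_eq_mul, aeval_eq_eval]
      ring

/-- A nonzero coordinate of `y` can be cancelled from the first family, which puts `[x]` in `X`. A
local formula for `f` that is nonzero at `[x]` then makes the second family say that `y` is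
proportional to its value. -/
theorem mem_image_of_forall_mem_graphEquations (hf : IsRegularOn k X f) (hX : IsClosed X)
    {x : Fin (n + 1) → k} (hx : x ≠ 0) {y : ProjSpace k n}
    (h : ∀ P ∈ graphEquations X f, eval x (MvPolynomial.map (eval y.coords) P) = 0) :
    y ∈ f '' X := by
  obtain ⟨j, hj⟩ := y.exists_coords_ne_zero
  have hxX : ProjSpace.mk x hx ∈ X := by
    by_contra hxX
    obtain ⟨H, hH, hHx⟩ := exists_mem_homogeneousVanishing hX hxX
    obtain ⟨d, hd⟩ := hH.1
    have := h _ (Or.inl ⟨H, hH, j, rfl⟩)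
    rw [eval_map_C_mul_X, mul_eq_zero, or_iff_left hj] at this
    exact hHx ((eval_coords_mk_eq_zero_iff hd x hx).2 this)
  refine ⟨_, hxX, ?_⟩
  obtain ⟨d, F, hF, hFx, hfF⟩ := hf _ hxX
  obtain ⟨a, -, ha⟩ := exists_coords_mk x hx
  rw [hfF _ hxX hFx, ← mk_coords y]
  refine mk_eq_of_smul _ _ (a ^ d * eval x (F j) / y.coords j) ?_
  funext i
  have := h _ (Or.inr ⟨d, F, hF, hfF, i, j, rfl⟩)
  rw [map_sub, map_sub, eval_map_C_mul_X, eval_map_C_mul_X, sub_eq_zero] at this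
  rw [ha, aeval_smul_of_isHomogeneous (hF i), aeval_eq_eval, Pi.smul_apply, smul_eq_mul]
  field_simp
  linear_combination -(a ^ d) * this

/-- A point is outside the image exactly when its graph equations have no nontrivial zero, an open
condition by elimination. -/
theorem isClosed_image [IsAlgClosed k] (hf : IsRegularOn k X f) (hX : IsClosed X) :
    IsClosed (f '' X) := by
  refine isClosed_of_forall_exists fun y hy => ?_
  obtain ⟨Δ, N, hΔ, hΔy, h⟩ := exists_isHomogeneous_forall_exists_eval_ne_zero
    (S := graphEquations X f) (fun _ => isHomogeneous_of_mem_graphEquations)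
    (fun _ => isHomogeneous_coeff_of_mem_graphEquations) y.coords fun x hx => by
      by_contra! hno
      exact hy (mem_image_of_forall_mem_graphEquations hf hX hx hno)
  refine ⟨Δ, N, hΔ, hΔy, ?_⟩
  rintro _ ⟨x, hx, rfl⟩
  by_contra hne
  obtain ⟨P, hP, hPx⟩ := h _ hne x.coords x.coords_ne_zero
  exact hPx (eval_eq_zero_of_mem_graphEquations hP hx)

end IsRegularOn
end Regular

/-! ### Dynamics on a closed subset of a Noetherian space -/

section Dynamics

open TopologicalSpace

variable {α : Type*} [TopologicalSpace α] {S : Set α} {f : α → α}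

theorem iterate_continuousOn (hf : ContinuousOn f S) (hS : Set.MapsTo f S S) (s : ℕ) :
    ContinuousOn f^[s] S := by
  induction s with
  | zero => exact continuousOn_id
  | succ s ih => exact ih.comp hf hS

theorem closure_image_closure_of_continuousOn (hf : ContinuousOn f S) (hS : IsClosed S)
    {A : Set α} (hA : A ⊆ S) : closure (f '' closure A) = closure (f '' A) := by
  refine Set.Subset.antisymm (closure_minimal ?_ isClosed_closure)
    (closure_mono (Set.image_mono subset_closure))
  exact (hf.mono (closure_minimal hA hS)).image_closure

theorem closure_image_iterate_eq (hf : ContinuousOn f S) (hfS : Set.MapsTo f S S)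
    (hS : IsClosed S) {V : Set α} (hV : V ⊆ S) (h : closure (f '' V) = V) (s : ℕ) :
    closure (f^[s] '' V) = V := by
  induction s with
  | zero => simpa using h ▸ isClosed_closure.closure_eq
  | succ s ih =>
    rw [Function.iterate_succ, Set.image_comp,
      ← closure_image_closure_of_continuousOn (iterate_continuousOn hf hfS s) hS
        ((hfS.mono_left hV).image_subset), h, ih]

theorem mapsTo_of_closure_image_eq {V : Set α} (h : closure (f '' V) = V) : Set.MapsTo f V V :=
  fun _ hx => h ▸ subset_closure (Set.mem_image_of_mem f hx)

/-- Some forward iterate of a point has, under some iterate of the map, an orbit whose closure is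
irreducible and invariant. -/
theorem exists_isIrreducible_closure_orbit [NoetherianSpace α] (hf : ContinuousOn f S)
    (hfS : Set.MapsTo f S S) (hS : IsClosed S) {x : α} (hx : x ∈ S) :
    ∃ r j : ℕ, 0 < r ∧
      IsIrreducible (closure (Set.range fun m : ℕ => (f^[r])^[m] (f^[j] x))) ∧
      closure (f^[r] '' closure (Set.range fun m : ℕ => (f^[r])^[m] (f^[j] x))) =
        closure (Set.range fun m : ℕ => (f^[r])^[m] (f^[j] x)) := by
  let O (r j : ℕ) : Set α := Set.range fun m : ℕ => (f^[r])^[m] (f^[j] x)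
  have hO (r j m : ℕ) : (f^[r])^[m] (f^[j] x) = f^[r * m + j] x := by
    rw [← Function.iterate_mul, ← Function.iterate_add_apply]
  have hOS (r j : ℕ) : O r j ⊆ S := by
    rintro _ ⟨m, rfl⟩
    simp only [hO]
    exact hfS.iterate _ hx
  have hsub (r j a b : ℕ) : O (r * a) (r * b + j) ⊆ O r j := by
    rintro _ ⟨m, rfl⟩
    refine ⟨a * m + b, ?_⟩
    simp only [hO]
    rw [show r * (a * m + b) + j = r * a * m + (r * b + j) by ring]
  have hwf : WellFoundedLT (Closeds α) := ((noetherianSpace_TFAE α).out 0 1).1 ‹_›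
  -- Among closures of orbits along arithmetic progressions, take a minimal one: every
  -- subprogression is then still dense in it.
  obtain ⟨_, ⟨r, j, hr, rfl⟩, hmin⟩ := hwf.wf.has_min
    {C : Closeds α | ∃ r j : ℕ, 0 < r ∧ C = Closeds.closure (O r j)} ⟨_, 1, 0, one_pos, rfl⟩
  have hdense (a b : ℕ) (ha : 0 < a) : closure (O (r * a) (r * b + j)) = closure (O r j) := by
    have h := hmin _ ⟨r * a, r * b + j, Nat.mul_pos hr ha, rfl⟩
    have hle : Closeds.closure (O (r * a) (r * b + j)) ≤ Closeds.closure (O r j) :=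
      closure_mono (hsub r j a b)
    exact congrArg SetLike.coe (hle.eq_of_not_lt h)
  have hcont := iterate_continuousOn hf hfS r
  have hinv : closure (f^[r] '' closure (O r j)) = closure (O r j) := by
    rw [closure_image_closure_of_continuousOn hcont hS (hOS r j), ← hdense 1 1 one_pos]
    congr 1
    rw [← Set.range_comp]
    refine congrArg Set.range (funext fun m => ?_)
    rw [Function.comp_apply, hO, hO, ← Function.iterate_add_apply,
      show r * 1 * m + (r * 1 + j) = r + (r * m + j) by ring]
  refine ⟨r, j, hr, ?_, hinv⟩
  have hWS : closure (O r j) ⊆ S := closure_minimal (hOS r j) hS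
  have hmaps := mapsTo_of_closure_image_eq hinv
  -- For irreducibility, cover the closure by finitely many irreducible closed pieces. Each piece is
  -- mapped into some piece, so by pigeonhole a piece met by the orbit is mapped into itself by a
  -- power. It contains a subprogression, hence the whole closure.
  obtain ⟨T, hTfin, hTc, hTi, hWT⟩ :=
    NoetherianSpace.exists_finite_set_isClosed_irreducible (isClosed_closure (s := O r j))
  have hstep (Z : T) : ∃ Z' : T, Set.MapsTo f^[r] Z.1 Z'.1 := by
    have hZW : Z.1 ⊆ closure (O r j) := hWT ▸ Set.subset_sUnion_of_mem Z.2
    have himg := (hTi _ Z.2).image _ (hcont.mono (hZW.trans hWS))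
    obtain ⟨Z', hZ', h⟩ := isIrreducible_iff_sUnion_isClosed.1 himg hTfin.toFinset
      (fun z hz => hTc z (hTfin.mem_toFinset.1 hz)) (by
        rw [hTfin.coe_toFinset, ← hWT]
        exact (hmaps.mono_left hZW).image_subset)
    exact ⟨⟨Z', hTfin.mem_toFinset.1 hZ'⟩, Set.mapsTo_iff_image_subset.2 h⟩
  choose σ hσ using hstep
  have hσ' (Z : T) (a : ℕ) : Set.MapsTo (f^[r])^[a] Z.1 (σ^[a] Z).1 := by
    induction a with
    | zero => exact Set.mapsTo_id _
    | succ a ih =>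
      rw [Function.iterate_succ', Function.iterate_succ']
      exact (hσ _).comp ih
  have hy : f^[j] x ∈ ⋃₀ T := hWT ▸ subset_closure ⟨0, rfl⟩
  obtain ⟨Z₀, hZ₀, hyZ⟩ := hy
  have := hTfin.to_subtype
  obtain ⟨a, b, hab, heq⟩ : ∃ a b : ℕ, a < b ∧ σ^[a] ⟨Z₀, hZ₀⟩ = σ^[b] ⟨Z₀, hZ₀⟩ := by
    obtain ⟨a, b, hne, h⟩ :=
      Finite.exists_ne_map_eq_of_infinite fun a : ℕ => σ^[a] (⟨Z₀, hZ₀⟩ : T)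
    rcases hne.lt_or_gt with h' | h'
    exacts [⟨a, b, h', h⟩, ⟨b, a, h', h.symm⟩]
  obtain ⟨c, rfl⟩ := Nat.exists_eq_add_of_lt hab
  set Z : T := σ^[a] ⟨Z₀, hZ₀⟩ with hZ
  have hmapsZ : Set.MapsTo (f^[r])^[c + 1] Z.1 Z.1 := by
    have h := hσ' Z (c + 1)
    rwa [hZ, ← Function.iterate_add_apply, show c + 1 + a = a + c + 1 by ring, ← heq] at h
  have hWZ : closure (O r j) ⊆ Z.1 := by
    rw [← hdense (c + 1) a c.succ_pos]
    refine closure_minimal ?_ (hTc _ Z.2)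
    rintro _ ⟨m, rfl⟩
    have hya : f^[r * a + j] x ∈ Z.1 := by
      rw [← hO]
      exact hσ' ⟨Z₀, hZ₀⟩ a hyZ
    rw [Function.iterate_mul f r (c + 1)]
    exact hmapsZ.iterate m hya
  have hZW : Z.1 ⊆ closure (O r j) := hWT ▸ Set.subset_sUnion_of_mem Z.2
  have hirr := hTi _ Z.2
  rwa [hZW.antisymm hWZ] at hirr

end Dynamics

/-! ### Growth rates along iterates -/

section Growth

theorem liminf_pow_le_liminf_mul (b : ℕ → ℝ≥0∞) {s : ℕ} (hs : 0 < s) :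
    liminf b atTop ^ s ≤ liminf (fun m => b (s * m) ^ s) atTop := by
  have hle : liminf b atTop ≤ liminf (fun m => b (s * m)) atTop :=
    liminf_le_liminf_of_le (u := b) (g := map (fun m => s * m) atTop)
      (tendsto_id.const_mul_atTop' (r := s) hs : Tendsto (fun m => s * m) atTop atTop)
  refine (pow_le_pow_left₀ zero_le hle s).trans (le_of_eq ?_)
  exact (pow_left_mono s).map_liminf_of_continuousAt (fun m => b (s * m))
    (ENNReal.continuous_pow s).continuousAt

variable {k : Type v} [Field k] {n : ℕ}

/-- The sequence for `f^[s]` comes from a subsequence of the one for `f`, and a lower limit can only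
grow on a subsequence. No existence of limits is needed. -/
theorem dynamicalDegree_pow_le (X : Set (ProjSpace k n)) (f : ProjSpace k n → ProjSpace k n)
    {s : ℕ} (hs : 0 < s) : dynamicalDegree X f ^ s ≤ dynamicalDegree X f^[s] := by
  have hs' : (s : ℝ) ≠ 0 := by positivity
  rw [dynamicalDegree, dynamicalDegree]
  refine (liminf_pow_le_liminf_mul _ hs).trans (le_of_eq (congrArg (liminf · atTop) ?_))
  funext m
  rw [← ENNReal.rpow_natCast, ← ENNReal.rpow_mul, ← Function.iterate_mul]
  congr 1
  rw [Nat.cast_mul, one_div_mul_eq_div, mul_comm (s : ℝ), div_mul_cancel_right₀ hs', one_div]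

variable [CharZero k]

theorem one_le_arithmeticDegree (f : ProjSpace k n → ProjSpace k n) (x : ProjSpace k n) :
    1 ≤ arithmeticDegree f x := by
  refine le_limsup_of_frequently_le (Frequently.of_forall fun m => ?_)
  rw [← ENNReal.one_rpow (1 / (m : ℝ))]
  exact ENNReal.rpow_le_rpow (ENNReal.one_le_ofReal.2 (le_max_left _ _)) (by positivity)

/-- For `c` above the arithmetic degree, the height at time `s * i + j` is eventually at most `c ^
(s * i + j)`. Its `i`-th root is then at most `c ^ (s + j / i)`, which tends to `c ^ s`. -/
theorem arithmeticDegree_iterate_lt {X : Set (ProjSpace k n)} {f : ProjSpace k n → ProjSpace k n}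
    {x : ProjSpace k n} (h : arithmeticDegree f x < dynamicalDegree X f) {s : ℕ} (hs : 0 < s)
    (j : ℕ) : arithmeticDegree f^[s] (f^[j] x) < dynamicalDegree X f^[s] := by
  obtain ⟨c', hc', hc'd⟩ := ENNReal.lt_iff_exists_nnreal_btwn.1 h
  obtain ⟨c, hc, hcc'⟩ := ENNReal.lt_iff_exists_nnreal_btwn.1 hc'
  have hc0 : (c : ℝ≥0∞) ≠ 0 := (zero_le.trans_lt hc).ne'
  refine lt_of_le_of_lt ?_ (((ENNReal.pow_lt_pow_left hs.ne' hcc').trans_le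
    (pow_le_pow_left₀ zero_le hc'd.le s)).trans_le (dynamicalDegree_pow_le X f hs))
  have hlim : Tendsto (fun i : ℕ => (c : ℝ≥0∞) ^ ((s : ℝ) + j / i)) atTop (nhds
      ((c : ℝ≥0∞) ^ s)) := by
    have hc0' : c ≠ 0 := ENNReal.coe_ne_zero.1 hc0
    simp only [← ENNReal.coe_rpow_of_ne_zero hc0', ← ENNReal.coe_pow]
    rw [ENNReal.tendsto_coe, ← NNReal.rpow_natCast]
    refine tendsto_const_nhds.nnrpow ?_ (Or.inl hc0')
    simpa using tendsto_const_nhds.add (tendsto_const_div_atTop_nhds_zero_nat (j : ℝ))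
  rw [← hlim.limsup_eq]
  refine limsup_le_limsup ?_
  have hev := eventually_lt_of_limsup_lt hc
  have hto : Tendsto (fun i : ℕ => s * i + j) atTop atTop :=
    tendsto_atTop_mono (fun i => Nat.le_add_right _ _) (tendsto_id.const_mul_atTop' hs)
  filter_upwards [hto.eventually hev, eventually_gt_atTop 0] with i hi hi0
  have hi' : (0 : ℝ) < i := Nat.cast_pos.2 hi0
  have hN : (0 : ℝ) < (s * i + j : ℕ) := Nat.cast_pos.2 (by positivity)
  have hexp : (s : ℝ) + j / i = (s * i + j : ℕ) / i := by
    push_cast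
    field_simp
  rw [← Function.iterate_mul, ← Function.iterate_add_apply, hexp]
  refine le_trans (le_of_eq ?_) (ENNReal.rpow_le_rpow hi.le (div_nonneg hN.le hi'.le))
  rw [← ENNReal.rpow_mul]
  congr 1
  field_simp

end Growth

/-! ### Periodic subvarieties of small dynamical degree -/

section Periodic

open ProjSpace

variable {k : Type v} [Field k] {n : ℕ} {X : Set (ProjSpace k n)}
  {f : ProjSpace k n → ProjSpace k n}

theorem IsProjectiveVariety.isClosed {K : Type u} [Field K] [Algebra K k]
    (hX : IsProjectiveVariety K X) : IsClosed X := by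
  obtain ⟨S, hS, rfl⟩ := hX.defined_over
  refine isClosed_of_forall_exists fun x hx => ?_
  simp only [Set.mem_ofPred_eq, not_forall] at hx
  obtain ⟨F, hF, hFx⟩ := hx
  obtain ⟨d, hd⟩ := hS F hF
  have key (y : ProjSpace k n) : MvPolynomial.eval y.coords
      (MvPolynomial.map (algebraMap K k) F) = MvPolynomial.aeval y.coords F := by
    rw [MvPolynomial.eval_map, MvPolynomial.aeval_def]
  exact ⟨_, d, hd.map (algebraMap K k), by rwa [key], fun y hy => by rw [key]; exact hy F hF⟩

theorem IsSurjectiveEndomorphism.isRegularOn {K : Type u} [Field K] [Algebra K k]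
    (hf : IsSurjectiveEndomorphism K X f) : IsRegularOn K X f :=
  hf.regular

theorem IsSurjectiveEndomorphism.iterate {K : Type u} [Field K] [Algebra K k]
    (hf : IsSurjectiveEndomorphism K X f) (s : ℕ) : IsSurjectiveEndomorphism K X f^[s] where
  mapsTo := hf.mapsTo.iterate s
  surjOn := hf.surjOn.iterate s
  regular := hf.isRegularOn.iterate hf.mapsTo s

theorem IsSurjectiveEndomorphism.continuousOn {K : Type u} [Field K] [Algebra K k]
    (hf : IsSurjectiveEndomorphism K X f) : ContinuousOn f X :=
  (hf.isRegularOn.baseChange k).continuousOn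

/-- Invariance only says that the image is dense in `W`; closedness of images upgrades this to
surjectivity. -/
theorem IsSurjectiveEndomorphism.restrict {K L : Type*} [Field K] [Algebra K k] [Field L]
    [Algebra K L] [Algebra L k] [IsScalarTower K L k] [IsAlgClosed k]
    (hf : IsSurjectiveEndomorphism K X f) {W : Set (ProjSpace k n)} (hWX : W ⊆ X)
    (hW : IsClosed W) (hfW : IsInvariantSet f W) : IsSurjectiveEndomorphism L W f where
  mapsTo := mapsTo_of_closure_image_eq hfW
  surjOn := by
    have h := (((hf.isRegularOn.mono hWX).baseChange k).isClosed_image hW).closure_eq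
    exact (h.symm.trans hfW).ge
  regular := (hf.isRegularOn.mono hWX).baseChange L

theorem isInvariantSet_iterate_of_dvd {K : Type u} [Field K] [Algebra K k]
    (hf : IsSurjectiveEndomorphism K X f) (hX : IsClosed X) {V : Set (ProjSpace k n)}
    (hV : V ⊆ X) {p M : ℕ} (h : IsInvariantSet f^[p] V) (hpM : p ∣ M) :
    IsInvariantSet f^[M] V := by
  obtain ⟨q, rfl⟩ := hpM
  rw [Function.iterate_mul]
  exact closure_image_iterate_eq (hf.iterate p).continuousOn (hf.iterate p).mapsTo hX hV h q

/-- After time `s₀` no point of `P` can enter `V` for the first time, so a later visit can be traced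
back to time `s₀`; an earlier one persists by forward invariance. -/
theorem iterate_mem_of_disjoint_differences {V P : Set (ProjSpace k n)} (hV : Set.MapsTo f V V)
    {s₀ : ℕ} (h : ∀ s ≥ s₀, P ∩ (f^[s + 1] ⁻¹' V \ f^[s] ⁻¹' V) = ∅) {x : ProjSpace k n}
    (hx : x ∈ P) {j : ℕ} (hj : f^[j] x ∈ V) : f^[s₀] x ∈ V := by
  rcases le_total j s₀ with hle | hle
  · obtain ⟨i, rfl⟩ := Nat.exists_eq_add_of_le' hle
    rw [Function.iterate_add_apply]
    exact hV.iterate i hj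
  · induction j, hle using Nat.le_induction with
    | base => exact hj
    | succ j hle ih =>
      refine ih ?_
      by_contra hno
      exact (Set.eq_empty_iff_forall_notMem.1 (h j hle) x) ⟨hx, hj, hno⟩

end Periodic

/-- Under the Kawaguchi–Silverman conjecture, the orbit of a point of small arithmetic degree meets
a periodic subvariety of small dynamical degree. -/
theorem exists_mem_smallDegreePeriodic {k : Type u} [Field k] [CharZero k] {n : ℕ}
    {X : Set (ProjSpace k n)} {f : ProjSpace k n → ProjSpace k n}
    (K : Type u) [Field K] [NumberField K] [Algebra K k] [IsAlgClosure K k]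
    (hKS : ∀ (L : Type u) [Field L] [NumberField L] [Algebra L k] [IsAlgClosure L k],
      KawaguchiSilvermanConjecture L k)
    (hX : IsProjectiveVariety K X) (hf : IsSurjectiveEndomorphism K X f) {x : ProjSpace k n}
    (hx : x ∈ X) (hlt : arithmeticDegree f x < dynamicalDegree X f) :
    ∃ W ∈ smallDegreePeriodic X f, ∃ j : ℕ, f^[j] x ∈ W := by
  have : IsAlgClosed k := IsAlgClosure.isAlgClosed K
  have : Algebra.IsAlgebraic K k := IsAlgClosure.isAlgebraic
  obtain ⟨r, j, hr, hirr, hinv⟩ :=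
    exists_isIrreducible_closure_orbit hf.continuousOn hf.mapsTo hX.isClosed hx
  set W := closure (Set.range fun m : ℕ => (f^[r])^[m] (f^[j] x)) with hW
  have hyW : f^[j] x ∈ W := subset_closure ⟨0, rfl⟩
  have hWX : W ⊆ X := by
    refine closure_minimal ?_ hX.isClosed
    rintro _ ⟨m, rfl⟩
    exact (hf.mapsTo.iterate r).iterate m (hf.mapsTo.iterate j hx)
  -- `W` need not be defined over `K`, so the conjecture is applied over a finite extension.
  obtain ⟨L, hL, hdef⟩ :=
    ProjSpace.exists_finite_field_of_definition K (isClosed_closure : IsClosed W)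
  have : FiniteDimensional ℚ L := Module.Finite.trans K L
  have : NumberField L := {}
  have : Algebra.IsAlgebraic L k := Algebra.IsAlgebraic.tower_top (K := K) L
  have : IsAlgClosure L k := ⟨inferInstance, inferInstance⟩
  have hend : IsSurjectiveEndomorphism L W f^[r] :=
    (hf.iterate r).restrict hWX isClosed_closure hinv
  refine ⟨W, ⟨⟨hWX, isClosed_closure, hirr⟩, r, hr, hinv, ?_⟩, j, hyW⟩
  by_contra hge
  exact hKS L n W f^[r] ⟨hirr, hdef⟩ hend _ hyW
    ((arithmeticDegree_iterate_lt hlt hr j).trans_le (not_lt.1 hge)) subset_rfl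

/-- Let `K` be a number field with algebraic closure `k`. If the three questions have positive
answers over `K` and the Kawaguchi–Silverman conjecture holds (over every number field `L`, its
algebraic closure being taken to be `k`), then the small Arithmetic Non-Density conjecture holds
over `K`. -/
theorem mainTheorem12 (K : Type u) [Field K] [NumberField K] (k : Type u) [Field k] [CharZero k]
    [Algebra K k] [IsAlgClosure K k]
    (hQ : PositiveAnswers K k)
    (hKS : ∀ (L : Type u) [Field L] [NumberField L] [Algebra L k] [IsAlgClosure L k],
      KawaguchiSilvermanConjecture L k) :
    SmallArithmeticNonDensityConjecture K k := by
  have : Algebra.IsAlgebraic K k := IsAlgClosure.isAlgebraic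
  intro n X f hX hf d hd hdense
  obtain ⟨x₀, hx₀⟩ := hX.irreducible.nonempty
  by_cases hd1 : 1 < dynamicalDegree X f
  swap
  · have hempty : {x ∈ pointsOfDegreeLE K X d | arithmeticDegree f x < dynamicalDegree X f} = ∅ :=
      Set.eq_empty_iff_forall_notMem.2 fun x hx =>
        hd1 ((one_le_arithmeticDegree f x).trans_lt hx.2)
    rw [hempty, closure_empty] at hdense
    exact hdense hx₀
  obtain ⟨-, ⟨N, -, hN⟩, hfin⟩ := hQ n X f hX hf hd1 d hd
  have hM : 0 < N.factorial := N.factorial_pos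
  have hg := hf.iterate N.factorial
  have hg1 : 1 < dynamicalDegree X f^[N.factorial] :=
    (one_lt_pow₀ hd1 hM.ne').trans_le (dynamicalDegree_pow_le X f hM)
  -- The first question is asked for `g`, since the members of `S_g` need not be `f`-invariant.
  have hland := (hQ n X _ hX hg hg1 d hd).1
  replace hfin := hfin N.factorial hM
  set g := f^[N.factorial] with hgdef
  have hS (V) (hV : V ∈ invariantMaximalSmallDegree X g) : ∃ s : ℕ, ∀ x ∈ pointsOfDegreeLE K X d,
      ∀ j : ℕ, g^[j] x ∈ V → g^[s] x ∈ V := by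
    obtain ⟨s, hs⟩ := hland V hV.1.prop.1 hV.2
    exact ⟨s, fun x hx j hj =>
      iterate_mem_of_disjoint_differences (mapsTo_of_closure_image_eq hV.2) hs hx hj⟩
  choose! s hs using hS
  have hcover : {x ∈ pointsOfDegreeLE K X d | arithmeticDegree f x < dynamicalDegree X f} ⊆
      ⋃ V ∈ invariantMaximalSmallDegree X g, X ∩ g^[s V] ⁻¹' V := by
    rintro x ⟨hx, hxlt⟩
    obtain ⟨W, hW, j, hj⟩ := exists_mem_smallDegreePeriodic K hKS hX hg hx.1
      (arithmeticDegree_iterate_lt hxlt hM 0)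
    obtain ⟨V, hWV, hV⟩ := ProjSpace.exists_le_maximal_of_isIrreducible
      (P := fun W => W ∈ smallDegreePeriodic X g) (fun V hV => hV.1.2) hW
    have hjV : g^[j] x ∈ V := hWV hj
    obtain ⟨hVX, t, ht, hVt, hVlt⟩ := hV.prop
    rw [hgdef, ← Function.iterate_mul] at hVt hVlt
    have ht' : 0 < N.factorial * t := Nat.mul_pos hM ht
    have hVf : V ∈ smallDegreePeriodic X f := ⟨hVX, _, ht', hVt, hVlt⟩
    have hper : period f V ≤ N := by
      by_contra hlt
      -- `g^[j] x` is a point of `V` of degree at most `d`, which rules out a period larger than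
      -- `N`.
      refine (Set.eq_empty_iff_forall_notMem.1 (hN V hVf (not_le.1 hlt)) (g^[j] x)) ⟨hjV, ?_⟩
      exact (Nat.cast_le.2 ((hg.iterate j).isRegularOn.degree_le hx.1)).trans hx.2
    obtain ⟨hp, hpV⟩ : 0 < period f V ∧ IsInvariantSet f^[period f V] V :=
      Nat.sInf_mem (s := {s | 0 < s ∧ IsInvariantSet f^[s] V}) ⟨_, ht', hVt⟩
    have hVS : V ∈ invariantMaximalSmallDegree X g :=
      ⟨hV, isInvariantSet_iterate_of_dvd hf hX.isClosed hVX.1 hpV (Nat.dvd_factorial hp hper)⟩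
    exact Set.mem_biUnion hVS ⟨hx.1, hs V hVS x hx j hjV⟩
  have hclosed (V) (hV : V ∈ invariantMaximalSmallDegree X g) :
      IsClosed (X ∩ g^[s V] ⁻¹' V) :=
    (hg.iterate (s V)).continuousOn.preimage_isClosed_of_isClosed hX.isClosed hV.1.prop.1.2.1
  have hXsub := hdense.trans (closure_minimal hcover (hfin.isClosed_biUnion hclosed))
  obtain ⟨Z, hZ, hXZ⟩ := isIrreducible_iff_sUnion_isClosed.1 hX.irreducible
    (hfin.image fun V => X ∩ g^[s V] ⁻¹' V).toFinset (by simpa using hclosed) (by simpa using hXsub)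
  obtain ⟨V, hV, rfl⟩ := (hfin.image _).mem_toFinset.1 hZ
  have hXV : X ⊆ V := fun y hy => by
    obtain ⟨x, hx, rfl⟩ := (hg.iterate (s V)).surjOn hy
    exact (hXZ hx).2
  obtain ⟨hVX, t, -, -, hlt⟩ := hV.1.prop
  rw [hVX.1.antisymm hXV] at hlt
  exact lt_irrefl _ hlt

end
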